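/- Let $\mathcal G$ be a finite graph (not necessarily planar; parallel edges and loops are allowed) whose edges $e$ carry positive weights (conductances) $c_e$, and in which some of the vertices are distinguished as nodes, such that every connected component of $\mathcal G$ contains at least one node. The vertices that are not nodes are called internal. The response matrix $L=(L_{i,j})$, indexed by the nodes, is the unique matrix such that, for every vector $v$ of potentials applied to the nodes, $Lv$ is the vector of net currents out of the network at the nodes when no current is lost at the internal vertices. That is, if $\varphi$ is a real function on the vertices which equals $v$ on the nodes and satisfies $I_\varphi(x)=0$ at every internal vertex $x$, where $I_\varphi(x)=\sum_{e=\{x,y\}} c_e(\varphi(y)-\varphi(x))$ (sum over the edges $e$ at $x$, with $y$ the other endpoint of $e$), then $(Lv)_i=I_\varphi(i)$ for every node $i$. A grove is a spanning forest of $\mathcal G$ in which every component tree contains at least one node; it determines the partition of the nodes in which two nodes are in the same part if and only if they are in the same component tree. A random grove is chosen with probability proportional to the product of its edge weights; $\Pr[\sigma]$ is the probability that it determines the partition $\sigma$, and $\Pr[\mathrm{uncrossing}]$ is the probability that no two nodes are connected, i.e. that every node is a singleton part. Theorem. Suppose that $A=\{a_1,\dots,a_k\}$, $B=\{b_1,\dots,b_k\}$,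 $C=\{c_1,\dots,c_m\}$ and $D=\{d_1,\dots,d_l\}$ (elements listed without repetition) are pairwise disjoint sets of nodes with $|A|=|B|=k$, and that $A\cup B\cup C\cup D$ is the set of all nodes. Then $$\det [L_{i,j}]^{i=a_1,\dots,a_k,c_1,\dots,c_m}_{j=b_1,\dots,b_k,c_1,\dots,c_m}=(-1)^{|C|}\,\frac{\sum_{\pi} (-1)^{\pi}\, \Pr[a_1,b_{\pi(1)}|\cdots|a_k,b_{\pi(k)}|d_1|\cdots|d_l]}{\Pr[\mathrm{uncrossing}]},$$ where $\pi$ runs over the permutations of $\{1,\dots,k\}$, $(-1)^\pi$ is the sign of $\pi$, and $\Pr[a_1,b_{\pi(1)}|\cdots|a_k,b_{\pi(k)}|d_1|\cdots|d_l]$ is the probability that a random grove determines a partition of the nodes into $k+l$ parts obtained from these $k+l$ listed parts by placing each node of $C$ into any one of them. -/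

import Mathlib

/-- A finite resistor network.  The underlying graph has vertex type `V` and edge type `E`; parallel
edges and loops are allowed, and no planarity is assumed.  Each edge carries a positive conductance
(its weight), some of the vertices are distinguished as nodes (indexed by `N`), and every connected
component of the graph contains at least one node. -/
structure ResistorNetwork (V E N : Type*) where
  ends : E → Sym2 V
  weight : E → ℝ
  weight_pos : ∀ e, 0 < weight e
  node : N ↪ V
  exists_node_reachable :
    ∀ v : V, ∃ i : N, (SimpleGraph.fromEdgeSet (Set.range ends)).Reachable v (node i)

namespace ResistorNetwork

variable {V E N : Type*} (G : ResistorNetwork V E N)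

section Response

open Classical in
/-- The total conductance between two vertices: the sum of the weights of the edges joining
them. -/
noncomputable def conductance [Fintype E] (v u : V) : ℝ :=
  ∑ e : E with G.ends e = s(v, u), G.weight e

/-- For the potential `φ`, the net current that flows through the edges of the network into `v`,
hence out of the network at `v`.  (By Ohm's law, the current from `u` to `v` is the conductance
times `φ u - φ v`.) -/
noncomputable def netCurrent [Fintype V] [Fintype E] (φ : V → ℝ) (v : V) : ℝ :=
  ∑ u : V, G.conductance v u * (φ u - φ v)

/-- There is no current loss at the internal vertices, i.e. at the vertices that are not nodes. -/
def NoInternalLoss [Fintype V] [Fintype E] (φ : V → ℝ) : Prop :=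
  ∀ v : V, v ∉ Set.range G.node → G.netCurrent φ v = 0

/-- `L` sends every vector of potentials on the nodes to the vector of net currents out of the
nodes, when there is no current loss at the internal vertices. -/
def IsResponseMatrix [Fintype V] [Fintype E] [Fintype N] (L : Matrix N N ℝ) : Prop :=
  ∀ φ : V → ℝ, G.NoInternalLoss φ →
    L.mulVec (fun i => φ (G.node i)) = fun i => G.netCurrent φ (G.node i)

variable {G} in
theorem conductance_comm [Fintype E] (v u : V) : G.conductance v u = G.conductance u v := by
  unfold conductance
  rw [Sym2.eq_swap]

variable {G} in
theorem conductance_nonneg [Fintype E] (v u : V) : 0 ≤ G.conductance v u :=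
  Finset.sum_nonneg fun e _ => (G.weight_pos e).le

variable {G} in
theorem conductance_pos [Fintype E] {v u : V} {e : E} (h : G.ends e = s(v, u)) :
    0 < G.conductance v u := by
  classical
  exact Finset.sum_pos (fun e _ => G.weight_pos e) ⟨e, by simp [h]⟩

variable {G} in
theorem sum_mul_netCurrent [Fintype V] [Fintype E] (φ : V → ℝ) :
    2 * ∑ v, φ v * G.netCurrent φ v =
      -∑ v, ∑ u, G.conductance v u * (φ u - φ v) ^ 2 := by
  have h1 : ∑ v, φ v * G.netCurrent φ v =
      ∑ v, ∑ u, G.conductance v u * (φ v * (φ u - φ v)) := by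
    refine Finset.sum_congr rfl fun v _ => ?_
    rw [netCurrent, Finset.mul_sum]
    exact Finset.sum_congr rfl fun u _ => by ring
  have h2 : ∑ v, φ v * G.netCurrent φ v =
      ∑ v, ∑ u, G.conductance v u * (φ u * (φ v - φ u)) := by
    rw [h1, Finset.sum_comm]
    exact Finset.sum_congr rfl fun v _ => Finset.sum_congr rfl fun u _ => by
      rw [conductance_comm]
  rw [two_mul]
  nth_rewrite 1 [h1]
  rw [h2, ← Finset.sum_add_distrib, ← Finset.sum_neg_distrib]
  refine Finset.sum_congr rfl fun v _ => ?_
  rw [← Finset.sum_add_distrib, ← Finset.sum_neg_distrib]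
  exact Finset.sum_congr rfl fun u _ => by ring

variable {G} in
/-- A potential without internal loss that vanishes at the nodes is zero. -/
theorem eq_zero_of_noInternalLoss [Fintype V] [Fintype E] {φ : V → ℝ}
    (h : G.NoInternalLoss φ) (h0 : ∀ i, φ (G.node i) = 0) : φ = 0 := by
  have hs : ∑ v, ∑ u, G.conductance v u * (φ u - φ v) ^ 2 = 0 := by
    have h1 := sum_mul_netCurrent (G := G) φ
    have h2 : ∑ v, φ v * G.netCurrent φ v = 0 := by
      refine Finset.sum_eq_zero fun v _ => ?_
      by_cases hv : v ∈ Set.range G.node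
      · obtain ⟨i, rfl⟩ := hv
        rw [h0, zero_mul]
      · rw [h v hv, mul_zero]
    linarith
  have hnn : ∀ v u, 0 ≤ G.conductance v u * (φ u - φ v) ^ 2 := fun v u =>
    mul_nonneg (conductance_nonneg v u) (sq_nonneg _)
  have hz : ∀ v u, G.conductance v u * (φ u - φ v) ^ 2 = 0 := fun v u => by
    have h1 := (Finset.sum_eq_zero_iff_of_nonneg
      (fun v _ => Finset.sum_nonneg fun u _ => hnn v u)).1 hs v (Finset.mem_univ v)
    exact (Finset.sum_eq_zero_iff_of_nonneg (fun u _ => hnn v u)).1 h1 u (Finset.mem_univ u)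
  have hwalk : ∀ v w, (SimpleGraph.fromEdgeSet (Set.range G.ends)).Reachable v w →
      φ v = φ w := by
    rintro v w ⟨p⟩
    induction p with
    | nil => rfl
    | cons hadj _ ih =>
      rw [← ih]
      obtain ⟨⟨e, he⟩, -⟩ := (SimpleGraph.fromEdgeSet_adj _).1 hadj
      rcases mul_eq_zero.1 (hz _ _) with h' | h'
      · exact absurd h' (conductance_pos he).ne'
      · exact (sub_eq_zero.1 (pow_eq_zero_iff two_ne_zero |>.1 h')).symm
  funext v
  obtain ⟨i, hi⟩ := G.exists_node_reachable v
  rw [hwalk v _ hi, h0, Pi.zero_apply]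

/-- The net current as a linear map. -/
noncomputable def netCurrentLin [Fintype V] [Fintype E] : (V → ℝ) →ₗ[ℝ] (V → ℝ) where
  toFun := G.netCurrent
  map_add' φ ψ := by
    funext v
    simp only [netCurrent, Pi.add_apply, ← Finset.sum_add_distrib]
    exact Finset.sum_congr rfl fun u _ => by ring
  map_smul' r φ := by
    funext v
    simp only [netCurrent, Pi.smul_apply, smul_eq_mul, RingHom.id_apply, Finset.mul_sum]
    exact Finset.sum_congr rfl fun u _ => by ring

/-- Potentials on the nodes extend without internal loss, linearly. -/
theorem exists_extension [Fintype V] [Fintype E] :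
    ∃ H : (N → ℝ) →ₗ[ℝ] (V → ℝ),
      ∀ x, G.NoInternalLoss (H x) ∧ ∀ i, H x (G.node i) = x i := by
  classical
  let T : (V → ℝ) →ₗ[ℝ] (V → ℝ) := LinearMap.pi fun v =>
    if v ∈ Set.range G.node then LinearMap.proj v
    else (LinearMap.proj v).comp G.netCurrentLin
  have hT1 : ∀ φ i, T φ (G.node i) = φ (G.node i) := fun φ i => by simp [T]
  have hT2 : ∀ φ v, v ∉ Set.range G.node → T φ v = G.netCurrent φ v := fun φ v hv => by
    simp only [T, LinearMap.pi_apply, if_neg hv]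
    rfl
  have hinj : Function.Injective T := by
    rw [← LinearMap.ker_eq_bot, LinearMap.ker_eq_bot']
    intro φ hφ
    refine eq_zero_of_noInternalLoss (G := G) (fun v hv => ?_) fun i => ?_
    · rw [← hT2 φ v hv, hφ, Pi.zero_apply]
    · rw [← hT1 φ i, hφ, Pi.zero_apply]
  let e := LinearEquiv.ofInjectiveEndo T hinj
  have he : ∀ y, T (e.symm y) = y := fun y => e.apply_symm_apply y
  let X : (N → ℝ) →ₗ[ℝ] (V → ℝ) := Function.ExtendByZero.linearMap ℝ G.node
  have hX1 : ∀ x i, X x (G.node i) = x i := fun x i => G.node.injective.extend_apply _ _ _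
  have hX2 : ∀ x v, v ∉ Set.range G.node → X x v = 0 := fun x v hv =>
    Function.extend_apply' _ _ _ hv
  refine ⟨e.symm.toLinearMap.comp X, fun x => ⟨fun v hv => ?_, fun i => ?_⟩⟩
  · rw [← hT2 _ v hv]
    exact (congrFun (he _) v).trans (hX2 x v hv)
  · exact (hT1 _ i).symm.trans ((congrFun (he _) _).trans (hX1 x i))

theorem existsUnique_isResponseMatrix [Fintype V] [Fintype E] [Fintype N] :
    ∃! L : Matrix N N ℝ, G.IsResponseMatrix L := by
  classical
  obtain ⟨H, hH⟩ := G.exists_extension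
  let K : (N → ℝ) →ₗ[ℝ] (N → ℝ) :=
    (LinearMap.funLeft ℝ ℝ G.node).comp (G.netCurrentLin.comp H)
  refine ⟨LinearMap.toMatrix' K, fun φ hφ => ?_, fun L hL => ?_⟩
  · have h1 : H (fun i => φ (G.node i)) = φ := by
      rw [← sub_eq_zero]
      refine eq_zero_of_noInternalLoss (G := G) (fun v hv => ?_) fun i => ?_
      · have h2 : G.netCurrentLin (H (fun i => φ (G.node i)) - φ) v = 0 := by
          rw [map_sub, Pi.sub_apply]
          exact sub_eq_zero.2 (((hH _).1 v hv).trans (hφ v hv).symm)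
        exact h2
      · rw [Pi.sub_apply, (hH _).2, sub_self]
    rw [LinearMap.toMatrix'_mulVec]
    funext i
    change G.netCurrent (H (fun i => φ (G.node i))) (G.node i) = _
    rw [h1]
  · apply Matrix.toLin'.injective
    rw [Matrix.toLin'_toMatrix']
    refine LinearMap.ext fun x => ?_
    have h1 := hL (H x) (hH x).1
    have h2 : (fun i => H x (G.node i)) = x := funext (hH x).2
    rw [h2] at h1
    rw [Matrix.toLin'_apply, h1]
    rfl

/-- The response matrix `L` of the network. -/
noncomputable def responseMatrix [Fintype V] [Fintype E] [Fintype N] : Matrix N N ℝ :=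
  G.existsUnique_isResponseMatrix.choose

theorem isResponseMatrix_responseMatrix [Fintype V] [Fintype E] [Fintype N] :
    G.IsResponseMatrix G.responseMatrix :=
  G.existsUnique_isResponseMatrix.choose_spec.1

end Response

section Groves

/-- The simple graph on all the vertices whose adjacencies are given by the edges in `F`. -/
def edgeGraph (F : Finset E) : SimpleGraph V :=
  SimpleGraph.fromEdgeSet (G.ends '' (F : Set E))

/-- The edge set `F` has no cycle: no loops, no two parallel edges, and no cycle of length at least
three. -/
def IsForest (F : Finset E) : Prop :=
  (∀ e ∈ F, ¬ (G.ends e).IsDiag) ∧ Set.InjOn G.ends (F : Set E) ∧ (G.edgeGraph F).IsAcyclic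

/-- A grove is a spanning forest in which every component contains at least one node. -/
def IsGrove (F : Finset E) : Prop :=
  G.IsForest F ∧ ∀ v : V, ∃ i : N, (G.edgeGraph F).Reachable v (G.node i)

/-- The partition of the nodes determined by an edge set: two nodes are in the same part if and
only if they are in the same component. -/
def nodePartition (F : Finset E) : Setoid N :=
  (G.edgeGraph F).reachableSetoid.comap G.node

open Classical in
/-- The probability that the partition of the nodes determined by a random grove satisfies `P`,
when a grove has probability proportional to the product of its edge weights. -/
noncomputable def Pr [Fintype E] (P : Setoid N → Prop) : ℝ :=
  (∑ F : Finset E with G.IsGrove F ∧ P (G.nodePartition F), ∏ e ∈ F, G.weight e) /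
    ∑ F : Finset E with G.IsGrove F, ∏ e ∈ F, G.weight e

end Groves

end ResistorNetwork

/-- The partition which connects no nodes. -/
def IsUncrossing {N : Type*} (σ : Setoid N) : Prop := σ = ⊥

/-- The partition `σ` is of the form `a₁,b₁|⋯|aₖ,bₖ|d₁|⋯|dₗ`, where the `dⱼ` are the elements of `D`,
with each element of `N` that is not listed placed into any one of these parts.  The function `part`
tells into which of the `k + l` parts an element goes. -/
def IsPairing {N : Type*} {k : ℕ} (a b : Fin k → N) (D : Finset N) (σ : Setoid N) : Prop :=
  ∃ part : N → Fin k ⊕ D,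
    (∀ i, part (a i) = Sum.inl i) ∧ (∀ i, part (b i) = Sum.inl i) ∧
      (∀ d : D, part d = Sum.inr d) ∧ σ = Setoid.ker part

/-!
Write `Δ = M W Mᵀ` for the Laplacian of the network, with `M` the signed incidence matrix and `W`
the diagonal matrix of the conductances.  Eliminating the internal vertices shows that the response
matrix is minus the Schur complement of the internal block of `Δ` (`responseMatrix_eq`).  Hence the
minor of the response matrix in question is, up to the sign `(-1) ^ (k + |C|)`, the quotient of the
minor of `Δ` with rows `A ∪ C ∪ I` and columns `B ∪ C ∪ I` by the minor with rows and columns `I`,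
where `I` is the set of internal vertices (`det_responseMatrix_submatrix`).

Both minors are evaluated by the all-minors matrix-tree theorem (`det_laplacian_submatrix`).  The
Cauchy–Binet formula writes a minor of `Δ` as a sum over edge sets `F` of the weight of `F` times a
product of two minors of `M`.

* A minor of `M` with columns `F` is nonzero only if every component of `F` contains a root, that is
  a vertex whose row is left out.  Since the minor is square, counting forces `F` to be a forest
  with exactly one root in each component.  Conversely such a minor does not vanish in any domain; over
  `ℤ` it is therefore divisible by no prime, and it is `1` or `-1`.
* If both minors are nonzero, then each component of `F` contains either one vertex outside
  `A ∪ B ∪ C ∪ I`, or a pair `a i`, `b (π i)`.  The rows of a component add up to zero, so the row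
  of `b (π i)` can be exchanged for minus the row of `a i`.  This identifies the two minors up to
  the sign `(-1) ^ k * sign π` (`det_incidence_mul_det_incidence`).

The forests that remain are the groves whose partition is a pairing (`isGrove_and_isPairing_iff`),
and for the minor with rows and columns `I` they are the uncrossing groves.
-/

/-! ### The Cauchy–Binet formula -/

/-- The Cauchy–Binet formula.  The term `m F` belongs to a set `F` of column indices whose size is
that of the index type of the rows; to form minors, `F` is enumerated by some `f`, and the choice
does not matter, since `f` occurs in both minors. -/
theorem Matrix.det_mul_eq_sum_powersetCard {n E R : Type*} [Fintype n] [DecidableEq n] [Fintype E]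
    [DecidableEq E] [CommRing R] (A : Matrix n E R) (B : Matrix E n R) (m : Finset E → R)
    (hm : ∀ F : Finset E, F.card = Fintype.card n → ∃ f : n → E, Finset.univ.image f = F ∧
      m F = (A.submatrix id f).det * (B.submatrix f id).det) :
    (A * B).det = ∑ F ∈ Finset.powersetCard (Fintype.card n) Finset.univ, m F := by
  have expand : (A * B).det =
      ∑ p : n → E, (A.submatrix id p).det * ∏ i, B (p i) i := by
    simp only [Matrix.det_apply', Matrix.mul_apply, Finset.prod_univ_sum, Finset.mul_sum,
      Fintype.piFinset_univ, Finset.sum_mul]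
    rw [Finset.sum_comm]
    refine Finset.sum_congr rfl fun p _ => Finset.sum_congr rfl fun σ _ => ?_
    rw [Finset.prod_mul_distrib, mul_assoc]
    rfl
  have hinj : ∀ p : n → E, p ∉ Finset.univ.filter (Function.Injective (α := n) (β := E)) →
      (A.submatrix id p).det * ∏ i, B (p i) i = 0 := by
    intro p hp
    simp only [Finset.mem_filter_univ, Function.Injective, not_forall] at hp
    obtain ⟨i, j, hij, hne⟩ := hp
    rw [Matrix.det_zero_of_column_eq hne fun r => by simp [hij], zero_mul]
  rw [expand, ← Finset.sum_subset (Finset.filter_subset (Function.Injective (α := n) (β := E)) _)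
    fun p _ hp => hinj p hp]
  rw [← Finset.sum_fiberwise_of_maps_to (t := Finset.powersetCard (Fintype.card n) Finset.univ)
    (g := fun p => Finset.univ.image p)]
  · refine Finset.sum_congr rfl fun F hF => ?_
    have hc := (Finset.mem_powersetCard_univ).1 hF
    obtain ⟨f, hfF, hmF⟩ := hm F hc
    have finj : Function.Injective f := by
      rw [← Set.injOn_univ, ← Finset.coe_univ, ← Finset.card_image_iff, hfF, hc, Finset.card_univ]
    symm
    rw [hmF, Matrix.det_apply' (B.submatrix f id), Finset.mul_sum]
    refine Finset.sum_bij (fun σ _ => f ∘ σ) ?_ ?_ ?_ ?_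
    · intro σ _
      simp only [Finset.mem_filter, Finset.mem_univ, true_and]
      refine ⟨finj.comp σ.injective, ?_⟩
      rw [← Finset.image_image, Finset.image_univ_equiv, hfF]
    · intro σ _ τ _ h
      exact Equiv.ext fun x => finj (congrFun h x)
    · intro p hp
      simp only [Finset.mem_filter, Finset.mem_univ, true_and] at hp
      have hex : ∀ i, ∃ j, f j = p i := fun i => by
        have : p i ∈ Finset.univ.image f := by
          rw [hfF, ← hp.2]
          exact Finset.mem_image_of_mem _ (Finset.mem_univ _)
        simpa using this
      choose σ hσ using hex
      have σinj : Function.Injective σ := fun x y h => hp.1 (by rw [← hσ, ← hσ, h])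
      exact ⟨Equiv.ofBijective σ (Finite.injective_iff_bijective.1 σinj), Finset.mem_univ _,
        funext hσ⟩
    · intro σ _
      have h1 : A.submatrix id (f ∘ σ) = (A.submatrix id f).submatrix id σ := rfl
      rw [h1, Matrix.det_permute']
      simp only [Matrix.submatrix_apply, id, Function.comp]
      ring
  · intro p hp
    rw [Finset.mem_powersetCard_univ, Finset.card_image_of_injective _ (Finset.mem_filter.1 hp).2,
      Finset.card_univ]

namespace ResistorNetwork

variable {V E N : Type*} (G : ResistorNetwork V E N)

/-! ### Spanning forests and their roots -/

/-- The first endpoint of `e`, for an arbitrary orientation of the edges. -/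
noncomputable def tail (e : E) : V := (Quot.out (G.ends e)).1

/-- The second endpoint of `e`, for an arbitrary orientation of the edges. -/
noncomputable def head (e : E) : V := (Quot.out (G.ends e)).2

theorem ends_eq (e : E) : G.ends e = s(G.tail e, G.head e) :=
  (Quot.out_eq (G.ends e)).symm

theorem edgeGraph_adj {F : Finset E} {u v : V} :
    (G.edgeGraph F).Adj u v ↔ (∃ e ∈ F, G.ends e = s(u, v)) ∧ u ≠ v := by
  simp [edgeGraph, SimpleGraph.fromEdgeSet_adj]

theorem edgeGraph_mono {F F' : Finset E} (h : F ⊆ F') : G.edgeGraph F ≤ G.edgeGraph F' :=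
  SimpleGraph.fromEdgeSet_mono (Set.image_mono (by exact_mod_cast h))

theorem reachable_tail_head {F : Finset E} {e : E} (he : e ∈ F) :
    (G.edgeGraph F).Reachable (G.tail e) (G.head e) := by
  by_cases h : G.tail e = G.head e
  · rw [h]
  · exact SimpleGraph.Adj.reachable (G.edgeGraph_adj.2 ⟨⟨e, he, G.ends_eq e⟩, h⟩)

/-- An equivalence relation that holds along the edges of `F` holds between any two vertices which
`F` connects. -/
theorem rel_of_reachable {F : Finset E} {r : V → V → Prop} (hr : Equivalence r)
    (h : ∀ e ∈ F, r (G.tail e) (G.head e)) {u v : V} (huv : (G.edgeGraph F).Reachable u v) :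
    r u v := by
  obtain ⟨p⟩ := huv
  induction p with
  | nil => exact hr.refl _
  | cons hadj _ ih =>
    refine hr.trans ?_ ih
    obtain ⟨⟨e, he, hs⟩, -⟩ := G.edgeGraph_adj.1 hadj
    rw [G.ends_eq, Sym2.eq_iff] at hs
    rcases hs with ⟨h1, h2⟩ | ⟨h1, h2⟩
    · rw [← h1, ← h2]; exact h e he
    · rw [← h1, ← h2]; exact hr.symm (h e he)

/-- If the endpoints of `e` stay connected without `e`, then the edge `e` can be removed from `F`
without changing the components. -/
theorem reachable_erase [DecidableEq E] {F : Finset E} {e : E}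
    (h : (G.edgeGraph (F.erase e)).Reachable (G.tail e) (G.head e)) {u v : V}
    (huv : (G.edgeGraph F).Reachable u v) : (G.edgeGraph (F.erase e)).Reachable u v := by
  refine G.rel_of_reachable (SimpleGraph.reachable_is_equivalence _) (fun e' he' => ?_) huv
  by_cases hee : e' = e
  · rw [hee]; exact h
  · exact G.reachable_tail_head (Finset.mem_erase.2 ⟨hee, he'⟩)

/-- An edge set is a forest if and only if each of its edges is needed to connect its own
endpoints. -/
theorem isForest_iff [DecidableEq E] {F : Finset E} :
    G.IsForest F ↔
      ∀ e ∈ F, ¬ (G.edgeGraph (F.erase e)).Reachable (G.tail e) (G.head e) := by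
  constructor
  · rintro ⟨hloop, hinj, hac⟩ e he hreach
    have hne : G.tail e ≠ G.head e := fun h => hloop e he (by rw [G.ends_eq]; exact h)
    have hadj : (G.edgeGraph F).Adj (G.tail e) (G.head e) :=
      G.edgeGraph_adj.2 ⟨⟨e, he, G.ends_eq e⟩, hne⟩
    refine SimpleGraph.isBridge_iff.1
      (SimpleGraph.isAcyclic_iff_forall_adj_isBridge.1 hac hadj) (hreach.mono ?_)
    intro u v huv
    obtain ⟨⟨e', he', hs⟩, huv'⟩ := G.edgeGraph_adj.1 huv
    rw [SimpleGraph.deleteEdges_adj]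
    refine ⟨G.edgeGraph_adj.2 ⟨⟨e', Finset.mem_of_mem_erase he', hs⟩, huv'⟩, fun h => ?_⟩
    rw [Set.mem_singleton_iff, ← hs, ← G.ends_eq] at h
    exact Finset.ne_of_mem_erase he' (hinj (Finset.mem_of_mem_erase he') he h)
  · intro h
    refine ⟨fun e he hd => ?_, fun e he e' he' hee => ?_, ?_⟩
    · rw [G.ends_eq] at hd
      have hd : G.tail e = G.head e := hd
      exact h e he (by rw [hd])
    · by_contra hne
      refine h e he ?_
      by_cases hd : G.tail e = G.head e
      · rw [hd]
      · exact SimpleGraph.Adj.reachable (G.edgeGraph_adj.2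
          ⟨⟨e', Finset.mem_erase.2 ⟨Ne.symm hne, he'⟩, by rw [← hee, G.ends_eq]⟩, hd⟩)
    · rw [SimpleGraph.isAcyclic_iff_forall_adj_isBridge]
      intro u v huv
      obtain ⟨⟨e, he, hs⟩, hne⟩ := G.edgeGraph_adj.1 huv
      rw [← hs, G.ends_eq, SimpleGraph.isBridge_iff]
      refine fun hreach => h e he (hreach.mono ?_)
      intro x y hxy
      rw [SimpleGraph.deleteEdges_adj] at hxy
      obtain ⟨⟨e', he', hs'⟩, hne'⟩ := G.edgeGraph_adj.1 hxy.1
      refine G.edgeGraph_adj.2 ⟨⟨e', Finset.mem_erase.2 ⟨?_, he'⟩, hs'⟩, hne'⟩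
      rintro rfl
      exact hxy.2 (by rw [Set.mem_singleton_iff, ← hs', G.ends_eq])

/-- If every component of `F` contains a root, then there are at least `|V| - |F|` roots: a function
on the vertices that is constant along `F` and vanishes at the roots is zero. -/
theorem card_le_of_rooted [Fintype V] {F : Finset E} {T : Finset V}
    (h : ∀ v, ∃ t ∈ T, (G.edgeGraph F).Reachable v t) :
    Fintype.card V ≤ T.card + F.card := by
  let Φ : (V → ℚ) →ₗ[ℚ] (T ⊕ F → ℚ) := LinearMap.pi <| Sum.elim
    (fun t => LinearMap.proj (R := ℚ) (φ := fun _ : V => ℚ) (t : V))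
    (fun e => LinearMap.proj (R := ℚ) (φ := fun _ : V => ℚ) (G.tail (e : E)) -
      LinearMap.proj (R := ℚ) (φ := fun _ : V => ℚ) (G.head e))
  have hΦ : Function.Injective Φ := by
    rw [← LinearMap.ker_eq_bot, LinearMap.ker_eq_bot']
    intro φ hφ
    funext v
    obtain ⟨t, ht, hvt⟩ := h v
    have hr : Equivalence fun u v => φ u = φ v := ⟨fun _ => rfl, Eq.symm, Eq.trans⟩
    rw [G.rel_of_reachable hr (fun e he => sub_eq_zero.1 (congrFun hφ (Sum.inr ⟨e, he⟩))) hvt]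
    exact congrFun hφ (Sum.inl ⟨t, ht⟩)
  simpa using LinearMap.finrank_le_finrank_of_injective hΦ

/-- If no two roots lie in the same component of the forest `F`, then there are at most `|V| - |F|`
roots. -/
theorem IsForest.card_le {G : ResistorNetwork V E N} [Fintype V] {F : Finset E}
    (hF : G.IsForest F) {T : Finset V}
    (h : ∀ t ∈ T, ∀ t' ∈ T, (G.edgeGraph F).Reachable t t' → t = t') :
    T.card + F.card ≤ Fintype.card V := by
  classical
  rw [isForest_iff] at hF
  induction F using Finset.induction_on generalizing T with
  | empty => simpa using Finset.card_le_univ T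
  | insert e F he ih =>
    have hle := G.edgeGraph_mono (Finset.subset_insert e F)
    have hbr := hF e (Finset.mem_insert_self e F)
    rw [Finset.erase_insert he] at hbr
    -- Without `e`, one of its endpoints is cut off from the roots and serves as a new root.
    obtain ⟨z, hz⟩ : ∃ z, ∀ t ∈ T, ¬ (G.edgeGraph F).Reachable z t := by
      by_contra! hcon
      obtain ⟨t, ht, h1⟩ := hcon (G.tail e)
      obtain ⟨t', ht', h2⟩ := hcon (G.head e)
      have htt : t = t' := h t ht t' ht' <| (h1.symm.mono hle).trans <|
        (G.reachable_tail_head (Finset.mem_insert_self e F)).trans (h2.mono hle)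
      exact hbr (h1.trans (htt ▸ h2.symm))
    have hzT : z ∉ T := fun hzT => hz z hzT (SimpleGraph.Reachable.refl _)
    have key := ih (T := insert z T) (fun e' he' hr => ?_) (fun t ht t' ht' hr => ?_)
    · rw [Finset.card_insert_of_notMem hzT] at key
      rw [Finset.card_insert_of_notMem he]
      omega
    · exact hF e' (Finset.mem_insert_of_mem he')
        (hr.mono (G.edgeGraph_mono (Finset.erase_subset_erase _ (Finset.subset_insert e F))))
    · rcases Finset.mem_insert.1 ht with rfl | ht1 <;> rcases Finset.mem_insert.1 ht' with rfl | ht2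
      · rfl
      · exact absurd hr (hz _ ht2)
      · exact absurd hr.symm (hz _ ht1)
      · exact h t ht1 t' ht2 (hr.mono hle)

/-- An edge set of the right size that connects every vertex to a root is a forest. -/
theorem isForest_of_rooted [Fintype V] {F : Finset E} {T : Finset V}
    (h : ∀ v, ∃ t ∈ T, (G.edgeGraph F).Reachable v t)
    (hcard : T.card + F.card ≤ Fintype.card V) : G.IsForest F := by
  classical
  rw [isForest_iff]
  intro e he hr
  have h1 := G.card_le_of_rooted (F := F.erase e) (T := T) fun v => by
    obtain ⟨t, ht, hvt⟩ := h v
    exact ⟨t, ht, G.reachable_erase hr hvt⟩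
  have h2 := Finset.card_erase_lt_of_mem he
  omega

/-- An edge set of the right size that connects every vertex to a root connects no two roots. -/
theorem root_unique_of_rooted [Fintype V] {F : Finset E} {T : Finset V}
    (h : ∀ v, ∃ t ∈ T, (G.edgeGraph F).Reachable v t)
    (hcard : T.card + F.card ≤ Fintype.card V) :
    ∀ t ∈ T, ∀ t' ∈ T, (G.edgeGraph F).Reachable t t' → t = t' := by
  classical
  intro t ht t' ht' hr
  by_contra hne
  have h1 := G.card_le_of_rooted (F := F) (T := T.erase t) fun v => by
    obtain ⟨x, hx, hvx⟩ := h v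
    by_cases hxt : x = t
    · exact ⟨t', Finset.mem_erase.2 ⟨Ne.symm hne, ht'⟩, (hxt ▸ hvx).trans hr⟩
    · exact ⟨x, Finset.mem_erase.2 ⟨hxt, hx⟩, hvx⟩
  have h2 := Finset.card_erase_lt_of_mem ht
  omega

/-- The edge set `F` is a spanning forest each of whose components contains exactly one of the roots
`ρ x`. -/
def IsRootedForest {r : Type*} (ρ : r → V) (F : Finset E) : Prop :=
  G.IsForest F ∧ ∀ v, ∃! x, (G.edgeGraph F).Reachable v (ρ x)

theorem card_eq_of_isRootedForest [Fintype V] {n r : Type*} [Fintype n] [Fintype r] {α : n → V}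
    {ρ : r → V} {F : Finset E} (hb : Function.Bijective (Sum.elim α ρ))
    (hF : G.IsRootedForest ρ F) : F.card = Fintype.card n := by
  classical
  have hρ : Function.Injective ρ := hb.injective.comp Sum.inr_injective
  have hV := Fintype.card_of_bijective hb
  rw [Fintype.card_sum] at hV
  have hT : (Finset.univ.image ρ).card = Fintype.card r := by
    rw [Finset.card_image_of_injective _ hρ, Finset.card_univ]
  have h1 := G.card_le_of_rooted (F := F) (T := Finset.univ.image ρ) fun v => by
    obtain ⟨x, hx, -⟩ := hF.2 v
    exact ⟨ρ x, Finset.mem_image_of_mem _ (Finset.mem_univ _), hx⟩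
  have h2 := hF.1.card_le (T := Finset.univ.image ρ) (by
    simp only [Finset.mem_image, Finset.mem_univ, true_and]
    rintro _ ⟨x, rfl⟩ _ ⟨y, rfl⟩ h
    rw [(hF.2 (ρ x)).unique (SimpleGraph.Reachable.refl _) h])
  omega

/-! ### Minors of the incidence matrix -/

/-- The signed vertex-edge incidence matrix.  Loops have the column zero. -/
noncomputable def incidence (R : Type*) [Ring R] [DecidableEq V] : Matrix V E R :=
  Matrix.of fun v e => (if v = G.tail e then 1 else 0) - (if v = G.head e then 1 else 0)

theorem incidence_apply {R : Type*} [Ring R] [DecidableEq V] (v : V) (e : E) :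
    G.incidence R v e = (if v = G.tail e then 1 else 0) - (if v = G.head e then 1 else 0) := rfl

theorem sum_mul_incidence {R : Type*} [Ring R] [Fintype V] [DecidableEq V] (φ : V → R) (e : E) :
    ∑ v, φ v * G.incidence R v e = φ (G.tail e) - φ (G.head e) := by
  simp [incidence_apply, mul_sub, Finset.sum_sub_distrib]

theorem map_incidence {R : Type*} [Ring R] [DecidableEq V] :
    (G.incidence ℤ).map (Int.cast : ℤ → R) = G.incidence R := by
  ext v e
  simp only [Matrix.map_apply, incidence_apply]
  push_cast
  rfl

theorem det_incidence_intCast {R n : Type*} [CommRing R] [DecidableEq V] [Fintype n]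
    [DecidableEq n] (α : n → V) (f : n → E) :
    ((G.incidence R).submatrix α f).det = (((G.incidence ℤ).submatrix α f).det : R) := by
  rw [← map_incidence, Matrix.submatrix_map, Int.cast_det]

section Minors

variable [Fintype V] [DecidableEq V] [DecidableEq E] {n r : Type*} [Fintype n] [DecidableEq n]
  [Fintype r] {α : n → V} {ρ : r → V} {F : Finset E} {f : n → E}

/-- The minor does not vanish if every component of `F` contains a root: a vector in the left
kernel, extended by zero to the roots, is constant along the edges of `F`, hence zero. -/
theorem det_incidence_ne_zero {R : Type*} [CommRing R] [IsDomain R]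
    (hb : Function.Bijective (Sum.elim α ρ)) (hf : Finset.univ.image f = F)
    (hroot : ∀ v, ∃ x, (G.edgeGraph F).Reachable v (ρ x)) :
    ((G.incidence R).submatrix α f).det ≠ 0 := by
  intro h0
  obtain ⟨x, hx, hx0⟩ := Matrix.exists_vecMul_eq_zero_iff.2 h0
  let eq := Equiv.ofBijective _ hb
  let φ : V → R := fun v => Sum.elim x 0 (eq.symm v)
  have hα : ∀ i, φ (α i) = x i := fun i => by
    have : eq.symm (α i) = Sum.inl i := eq.symm_apply_eq.2 rfl
    simp [φ, this]
  have hρ : ∀ i, φ (ρ i) = 0 := fun i => by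
    have : eq.symm (ρ i) = Sum.inr i := eq.symm_apply_eq.2 rfl
    simp [φ, this]
  have hr : Equivalence fun u v => φ u = φ v := ⟨fun _ => rfl, Eq.symm, Eq.trans⟩
  apply hx
  funext i
  obtain ⟨y, hy⟩ := hroot (α i)
  rw [← hα, G.rel_of_reachable hr (fun e he => ?_) hy, hρ, Pi.zero_apply]
  rw [← hf] at he
  obtain ⟨j, -, rfl⟩ := Finset.mem_image.1 he
  have h1 := congrFun hx0 j
  rw [← sub_eq_zero, ← sum_mul_incidence, ← hb.sum_comp, Fintype.sum_sum_type]
  simpa [hα, hρ, Matrix.vecMul, dotProduct] using h1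

/-- The minor is `1` or `-1`: it has no prime factor, since it does not vanish modulo any prime. -/
theorem det_incidence_mul_self (hb : Function.Bijective (Sum.elim α ρ))
    (hf : Finset.univ.image f = F)
    (hroot : ∀ v, ∃ x, (G.edgeGraph F).Reachable v (ρ x)) :
    ((G.incidence ℤ).submatrix α f).det * ((G.incidence ℤ).submatrix α f).det = 1 := by
  apply Int.isUnit_mul_self
  rw [Int.isUnit_iff_natAbs_eq, Nat.eq_one_iff_not_exists_prime_dvd]
  intro p hp hdvd
  have := Fact.mk hp
  refine G.det_incidence_ne_zero (R := ZMod p) hb hf hroot ?_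
  rw [det_incidence_intCast, ZMod.intCast_zmod_eq_zero_iff_dvd]
  exact Int.natCast_dvd.2 hdvd

theorem exists_reachable_of_det_incidence_ne_zero {R : Type*} [CommRing R] [IsDomain R]
    (hb : Function.Bijective (Sum.elim α ρ)) (hf : Finset.univ.image f = F)
    (h0 : ((G.incidence R).submatrix α f).det ≠ 0) (v : V) :
    ∃ x, (G.edgeGraph F).Reachable v (ρ x) := by
  classical
  by_contra! hv
  apply h0
  -- The indicator function of the component of `v` is a linear relation between the rows.
  let φ : V → R := fun u => if (G.edgeGraph F).Reachable v u then 1 else 0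
  rw [← Matrix.exists_vecMul_eq_zero_iff]
  refine ⟨fun i => φ (α i), fun h => ?_, ?_⟩
  · obtain ⟨i | i, hi⟩ := hb.surjective v
    · simp only [Sum.elim_inl] at hi
      have h1 := congrFun h i
      simp only [φ, hi, SimpleGraph.Reachable.refl, if_true, Pi.zero_apply] at h1
      exact one_ne_zero h1
    · exact hv i (by rw [← hi]; rfl)
  · funext j
    have hj : f j ∈ F := hf ▸ Finset.mem_image_of_mem _ (Finset.mem_univ j)
    have hφ : φ (G.tail (f j)) = φ (G.head (f j)) := by
      have := G.reachable_tail_head hj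
      simp only [φ]
      congr 1
      exact propext ⟨fun h => h.trans this, fun h => h.trans this.symm⟩
    have h1 := sub_eq_zero.2 hφ
    rw [← sum_mul_incidence, ← hb.sum_comp, Fintype.sum_sum_type] at h1
    have hρ : ∀ x, φ (ρ x) = 0 := fun x => if_neg (hv x)
    simpa [hρ, Matrix.vecMul, dotProduct] using h1

theorem isRootedForest_of_det_incidence_ne_zero {R : Type*} [CommRing R] [IsDomain R]
    (hb : Function.Bijective (Sum.elim α ρ)) (hf : Finset.univ.image f = F)
    (hcard : F.card = Fintype.card n)
    (h0 : ((G.incidence R).submatrix α f).det ≠ 0) : G.IsRootedForest ρ F := by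
  have hρ : Function.Injective ρ := hb.injective.comp Sum.inr_injective
  have hV := Fintype.card_of_bijective hb
  rw [Fintype.card_sum] at hV
  have hT : (Finset.univ.image ρ).card = Fintype.card r := by
    rw [Finset.card_image_of_injective _ hρ, Finset.card_univ]
  have hex := G.exists_reachable_of_det_incidence_ne_zero hb hf h0
  have hex' : ∀ v, ∃ t ∈ Finset.univ.image ρ, (G.edgeGraph F).Reachable v t := fun v => by
    obtain ⟨x, hx⟩ := hex v
    exact ⟨ρ x, Finset.mem_image_of_mem _ (Finset.mem_univ _), hx⟩
  refine ⟨G.isForest_of_rooted hex' (by omega), fun v => ?_⟩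
  obtain ⟨x, hx⟩ := hex v
  refine ⟨x, hx, fun y hy => hρ ?_⟩
  exact G.root_unique_of_rooted hex' (by omega) _ (Finset.mem_image_of_mem _ (Finset.mem_univ _)) _
    (Finset.mem_image_of_mem _ (Finset.mem_univ _)) (hy.symm.trans hx)

end Minors

section Pairing

variable [Fintype V] [DecidableEq V] [DecidableEq E] {ι S δ : Type*} [Fintype ι] [DecidableEq ι]
  [Fintype S] [DecidableEq S] [Fintype δ] {p q : ι → V} {s : S → V} {d : δ → V} {F : Finset E}
  {f : ι ⊕ S → E}

/-- If `p i` and `q i` are connected, then the row of `q i` is minus the row of `p i`, minus the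
rows of the other vertices of the same component. -/
theorem det_incidence_swap
    (hb : Function.Bijective (Sum.elim (Sum.elim p s) (Sum.elim q d)))
    (hf : Finset.univ.image f = F) (hF : G.IsRootedForest (Sum.elim q d) F)
    (hpq : ∀ i, (G.edgeGraph F).Reachable (p i) (q i)) :
    ((G.incidence ℤ).submatrix (Sum.elim q s) f).det =
      (-1) ^ Fintype.card ι * ((G.incidence ℤ).submatrix (Sum.elim p s) f).det := by
  classical
  have hroot : ∀ {x y}, (G.edgeGraph F).Reachable (Sum.elim q d x) (Sum.elim q d y) → x = y :=
    fun h => (hF.2 _).unique (SimpleGraph.Reachable.refl _) h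
  let X : Matrix ι S ℤ := Matrix.of fun i j =>
    if (G.edgeGraph F).Reachable (p i) (s j) then -1 else 0
  have hmul : (G.incidence ℤ).submatrix (Sum.elim q s) f =
      Matrix.fromBlocks (-1) X 0 1 * (G.incidence ℤ).submatrix (Sum.elim p s) f := by
    ext x j
    rw [Matrix.mul_apply, Fintype.sum_sum_type]
    rcases x with i | t
    · have hj : f j ∈ F := hf ▸ Finset.mem_image_of_mem _ (Finset.mem_univ j)
      let φ : V → ℤ := fun u => if (G.edgeGraph F).Reachable (p i) u then 1 else 0
      have hφ : φ (G.tail (f j)) = φ (G.head (f j)) := by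
        have := G.reachable_tail_head hj
        simp only [φ]
        congr 1
        exact propext ⟨fun h => h.trans this, fun h => h.trans this.symm⟩
      have hp : ∀ i', φ (p i') = if i = i' then 1 else 0 := fun i' => by
        simp only [φ]
        congr 1
        refine propext ⟨fun h => Sum.inl_injective (hroot (x := Sum.inl i) (y := Sum.inl i') ?_),
          fun h => by rw [h]⟩
        exact (hpq i).symm.trans (h.trans (hpq i'))
      have hq : ∀ i', φ (q i') = if i = i' then 1 else 0 := fun i' => by
        simp only [φ]
        congr 1
        refine propext ⟨fun h => Sum.inl_injective (hroot (x := Sum.inl i) (y := Sum.inl i') ?_),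
          fun h => by rw [← h]; exact hpq i⟩
        exact (hpq i).symm.trans h
      have hd : ∀ y, φ (d y) = 0 := fun y => if_neg fun h =>
        Sum.inl_ne_inr (hroot (x := Sum.inl i) (y := Sum.inr y) ((hpq i).symm.trans h))
      have h1 := sub_eq_zero.2 hφ
      rw [← sum_mul_incidence, ← hb.sum_comp] at h1
      simp only [Fintype.sum_sum_type, Sum.elim_inl, Sum.elim_inr, hp, hq, hd, ite_mul, one_mul,
        zero_mul, Finset.sum_ite_eq, Finset.mem_univ, if_true, Finset.sum_const_zero,
        add_zero] at h1
      have hX : ∀ t, X i t = -φ (s t) := fun t => by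
        simp only [X, φ, Matrix.of_apply]
        split_ifs <;> simp
      simp only [Matrix.fromBlocks_apply₁₁, Matrix.fromBlocks_apply₁₂, Matrix.submatrix_apply,
        Sum.elim_inl, Sum.elim_inr, hX, Matrix.neg_apply, Matrix.one_apply, neg_mul, ite_mul,
        one_mul, zero_mul, Finset.sum_neg_distrib, Finset.sum_ite_eq, Finset.mem_univ, if_true]
      simp only [φ, ite_mul, one_mul, zero_mul] at h1 ⊢
      linarith
    · simp [Matrix.one_apply]
  rw [hmul, Matrix.det_mul, Matrix.det_fromBlocks_zero₂₁, Matrix.det_one, mul_one, Matrix.det_neg,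
    Matrix.det_one, mul_one]

open Classical in
/-- The product of two minors of the incidence matrix that share the rows `s` and the columns `F`
detects the forests `F` in which each component contains one of the pairs `p i`, `q (π i)` or one of
the vertices `d j`, but no other vertex outside `s`. -/
theorem det_incidence_mul_det_incidence
    (hp : Function.Bijective (Sum.elim (Sum.elim p s) (Sum.elim q d)))
    (hq : Function.Bijective (Sum.elim (Sum.elim q s) (Sum.elim p d)))
    (hf : Finset.univ.image f = F) (hcard : F.card = Fintype.card (ι ⊕ S)) :
    ((G.incidence ℤ).submatrix (Sum.elim p s) f).det *
        ((G.incidence ℤ).submatrix (Sum.elim q s) f).det =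
      (-1) ^ Fintype.card ι * ∑ π : Equiv.Perm ι, (Equiv.Perm.sign π : ℤ) *
        if G.IsRootedForest (Sum.elim (q ∘ π) d) F ∧
          ∀ i, (G.edgeGraph F).Reachable (p i) (q (π i)) then 1 else 0 := by
  have hperm : ∀ π : Equiv.Perm ι,
      Function.Bijective (Sum.elim (Sum.elim p s) (Sum.elim (q ∘ π) d)) := fun π => by
    have h1 := hp.comp ((Equiv.refl (ι ⊕ S)).sumCongr (π.sumCongr (Equiv.refl δ))).bijective
    convert h1 using 1
    ext ((x | x) | (x | x)) <;> rfl
  by_cases hex : ∃ π : Equiv.Perm ι, G.IsRootedForest (Sum.elim (q ∘ π) d) F ∧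
      ∀ i, (G.edgeGraph F).Reachable (p i) (q (π i))
  · obtain ⟨π, hF, hπ⟩ := hex
    rw [Finset.sum_eq_single π]
    · rw [if_pos ⟨hF, hπ⟩, mul_one]
      have h1 := G.det_incidence_swap (hperm π) hf hF hπ
      have h2 := G.det_incidence_mul_self (hperm π) hf fun v => (hF.2 v).exists
      have h3 : (G.incidence ℤ).submatrix (Sum.elim (q ∘ π) s) f =
          ((G.incidence ℤ).submatrix (Sum.elim q s) f).submatrix
            (Equiv.Perm.sumCongr π (1 : Equiv.Perm S)) id := by
        ext (x | x) j <;> rfl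
      rw [h3, Matrix.det_permute, Equiv.Perm.sign_sumCongr, Equiv.Perm.sign_one, mul_one,
        Int.cast_id] at h1
      have h4 : ((Equiv.Perm.sign π : ℤˣ) : ℤ) * (Equiv.Perm.sign π : ℤˣ) = 1 := by
        rw [← Units.val_mul, Int.units_mul_self, Units.val_one]
      have h5 : ((G.incidence ℤ).submatrix (Sum.elim q s) f).det =
          (Equiv.Perm.sign π : ℤˣ) * ((-1) ^ Fintype.card ι *
            ((G.incidence ℤ).submatrix (Sum.elim p s) f).det) := by
        rw [← h1, ← mul_assoc, h4, one_mul]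
      rw [h5]
      linear_combination ((Equiv.Perm.sign π : ℤˣ) * (-1) ^ Fintype.card ι : ℤ) * h2
    · intro τ _ hne
      rw [if_neg, mul_zero]
      rintro ⟨-, hτ⟩
      refine hne (Equiv.ext fun i => ?_)
      have h1 := hF.2 (p i)
      have h2 := h1.unique (y₁ := Sum.inl i) (y₂ := Sum.inl (π.symm (τ i))) (hπ i)
        (by simpa using hτ i)
      rw [Sum.inl.injEq, Equiv.eq_symm_apply] at h2
      exact h2.symm
    · exact fun h => absurd (Finset.mem_univ _) h
  · rw [Finset.sum_eq_zero, mul_zero]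
    · by_contra hne
      have hPF := G.isRootedForest_of_det_incidence_ne_zero hp hf hcard (left_ne_zero_of_mul hne)
      have hQF := G.isRootedForest_of_det_incidence_ne_zero hq hf hcard (right_ne_zero_of_mul hne)
      have hex1 : ∀ i, ∃ j, (G.edgeGraph F).Reachable (p i) (q j) := fun i => by
        obtain ⟨j | y, hj, -⟩ := hPF.2 (p i)
        · exact ⟨j, hj⟩
        · exact absurd ((hQF.2 (p i)).unique (y₁ := Sum.inl i) (y₂ := Sum.inr y)
            (SimpleGraph.Reachable.refl _) hj) Sum.inl_ne_inr
      choose g hg using hex1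
      have ginj : Function.Injective g := fun i j hij => by
        have h1 : (G.edgeGraph F).Reachable (p i) (p j) := (hg i).trans (hij ▸ (hg j).symm)
        exact Sum.inl_injective ((hQF.2 (p i)).unique (y₁ := Sum.inl i) (y₂ := Sum.inl j)
          (SimpleGraph.Reachable.refl _) h1)
      let π := Equiv.ofBijective g (Finite.injective_iff_bijective.1 ginj)
      refine hex ⟨π, ⟨hPF.1, fun v => ?_⟩, hg⟩
      have h1 := (Equiv.existsUnique_congr_left (π.sumCongr (Equiv.refl δ)).symm).1 (hPF.2 v)
      convert h1 using 3 with x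
      rcases x with x | x <;> rfl
    · intro π _
      rw [if_neg fun h => hex ⟨π, h⟩, mul_zero]

end Pairing

/-! ### The all-minors matrix-tree theorem -/

/-- The weighted Laplacian `M W Mᵀ`, with `M` the incidence matrix and `W` the diagonal matrix of
the weights. -/
noncomputable def laplacian [Fintype E] [DecidableEq V] : Matrix V V ℝ :=
  (Matrix.of fun v e => G.weight e * G.incidence ℝ v e) * (G.incidence ℝ).transpose

open Classical in
/-- The Laplacian computes the net current, up to sign. -/
theorem laplacian_mulVec [Fintype V] [Fintype E] [DecidableEq V] (φ : V → ℝ) (v : V) :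
    (G.laplacian.mulVec φ) v = -G.netCurrent φ v := by
  have h1 : (G.laplacian.mulVec φ) v =
      ∑ e, G.weight e * (G.incidence ℝ v e * (φ (G.tail e) - φ (G.head e))) := by
    simp only [laplacian, ← sum_mul_incidence, Matrix.mulVec, dotProduct, Matrix.mul_apply,
      Matrix.of_apply, Matrix.transpose_apply, Finset.sum_mul, Finset.mul_sum]
    rw [Finset.sum_comm]
    exact Finset.sum_congr rfl fun e _ => Finset.sum_congr rfl fun u _ => by ring
  have h2 : G.netCurrent φ v =
      ∑ e, G.weight e * ∑ u, if G.ends e = s(v, u) then φ u - φ v else 0 := by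
    simp only [netCurrent, conductance, Finset.sum_filter, Finset.sum_mul, Finset.mul_sum, ite_mul,
      mul_ite, zero_mul, mul_zero]
    exact Finset.sum_comm
  rw [h1, h2, ← Finset.sum_neg_distrib]
  refine Finset.sum_congr rfl fun e _ => ?_
  rw [← mul_neg]
  congr 1
  rw [incidence_apply, ends_eq]
  by_cases ht : v = G.tail e
  · have : ∀ u, s(G.tail e, G.head e) = s(v, u) ↔ G.head e = u := fun u => by
      rw [ht]; exact Sym2.congr_right
    simp only [this, Finset.sum_ite_eq, Finset.mem_univ, if_true]
    rw [ht, if_pos rfl]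
    split_ifs with h
    · rw [← h]; ring
    · ring
  · by_cases hh : v = G.head e
    · have : ∀ u, s(G.tail e, G.head e) = s(v, u) ↔ G.tail e = u := fun u => by
        rw [hh, Sym2.eq_swap]; exact Sym2.congr_right
      simp only [this, Finset.sum_ite_eq, Finset.mem_univ, if_true, if_neg ht, if_pos hh]
      rw [hh]; ring
    · rw [if_neg ht, if_neg hh, Finset.sum_eq_zero, sub_zero, zero_mul, neg_zero]
      intro u _
      refine if_neg fun h => ?_
      rcases Sym2.eq_iff.1 h with ⟨h, -⟩ | ⟨-, h⟩
      · exact ht h.symm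
      · exact hh h.symm

open Classical in
/-- The all-minors matrix-tree theorem.  The rows left out are those of `q` and `d`, and the columns
left out are those of `p` and `d`. -/
theorem det_laplacian_submatrix [Fintype V] [Fintype E]
    {ι S δ : Type*} [Fintype ι] [DecidableEq ι] [Fintype S] [DecidableEq S] [Fintype δ]
    {p q : ι → V} {s : S → V} {d : δ → V}
    (hp : Function.Bijective (Sum.elim (Sum.elim p s) (Sum.elim q d)))
    (hq : Function.Bijective (Sum.elim (Sum.elim q s) (Sum.elim p d))) :
    (G.laplacian.submatrix (Sum.elim p s) (Sum.elim q s)).det =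
      (-1) ^ Fintype.card ι * ∑ π : Equiv.Perm ι, ((Equiv.Perm.sign π : ℤ) : ℝ) *
        ∑ F : Finset E with G.IsRootedForest (Sum.elim (q ∘ π) d) F ∧
          ∀ i, (G.edgeGraph F).Reachable (p i) (q (π i)), ∏ e ∈ F, G.weight e := by
  have hperm : ∀ π : Equiv.Perm ι,
      Function.Bijective (Sum.elim (Sum.elim p s) (Sum.elim (q ∘ π) d)) := fun π => by
    have h1 := hp.comp ((Equiv.refl (ι ⊕ S)).sumCongr (π.sumCongr (Equiv.refl δ))).bijective
    convert h1 using 1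
    ext ((x | x) | (x | x)) <;> rfl
  rw [laplacian, Matrix.submatrix_mul _ _ _ id _ Function.bijective_id,
    Matrix.det_mul_eq_sum_powersetCard _ _ (fun F => (-1) ^ Fintype.card ι *
      ∑ π : Equiv.Perm ι, ((Equiv.Perm.sign π : ℤ) : ℝ) *
        if G.IsRootedForest (Sum.elim (q ∘ π) d) F ∧
          ∀ i, (G.edgeGraph F).Reachable (p i) (q (π i)) then ∏ e ∈ F, G.weight e else 0)]
  · rw [← Finset.mul_sum, Finset.sum_comm]
    congr 1
    refine Finset.sum_congr rfl fun π _ => ?_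
    rw [← Finset.mul_sum, Finset.sum_filter]
    congr 1
    refine Finset.sum_subset (Finset.subset_univ _) fun F _ hF => if_neg fun h => hF ?_
    rw [Finset.mem_powersetCard_univ]
    exact G.card_eq_of_isRootedForest (hperm π) h.1
  · intro F hc
    let ε : ι ⊕ S ≃ F := Fintype.equivOfCardEq (by rw [← hc, Fintype.card_coe])
    have hf : Finset.univ.image (fun i => (ε i : E)) = F := by
      ext e
      simp only [Finset.mem_image, Finset.mem_univ, true_and]
      exact ⟨fun ⟨i, hi⟩ => hi ▸ (ε i).2, fun he => ⟨ε.symm ⟨e, he⟩, by simp⟩⟩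
    refine ⟨fun i => ε i, hf, ?_⟩
    have hw : ∏ j, G.weight (ε j) = ∏ e ∈ F, G.weight e := by
      rw [ε.prod_comp (fun e : F => G.weight e), Finset.prod_coe_sort]
    have h1 : ((Matrix.of fun v e => G.weight e * G.incidence ℝ v e).submatrix
        (Sum.elim p s) id).submatrix id (fun i => (ε i : E)) =
        Matrix.of fun i j => G.weight (ε j) *
          (G.incidence ℝ).submatrix (Sum.elim p s) (fun i => (ε i : E)) i j :=
      rfl
    have h2 : ((G.incidence ℝ).transpose.submatrix id (Sum.elim q s)).submatrix
        (fun i => (ε i : E)) id =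
        ((G.incidence ℝ).submatrix (Sum.elim q s) (fun i => (ε i : E))).transpose := rfl
    rw [h1, h2, Matrix.det_transpose, Matrix.det_mul_row, hw, det_incidence_intCast,
      G.det_incidence_intCast (Sum.elim q s), mul_assoc, ← Int.cast_mul,
      G.det_incidence_mul_det_incidence hp hq hf hc]
    push_cast
    rw [mul_left_comm]
    congr 1
    rw [Finset.mul_sum]
    refine Finset.sum_congr rfl fun π _ => ?_
    split_ifs <;> ring

/-! ### Groves and pairings -/

/-- A grove determines a pairing if and only if it has the `k + l` vertices `b i` and `d` as roots,
one in each component, and connects each `a i` to `b i`. -/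
theorem isGrove_and_isPairing_iff {k : ℕ} {a b : Fin k → N} {D : Finset N} {F : Finset E} :
    G.IsGrove F ∧ IsPairing a b D (G.nodePartition F) ↔
      G.IsRootedForest (Sum.elim (G.node ∘ b) fun d : D => G.node d) F ∧
        ∀ i, (G.edgeGraph F).Reachable (G.node (a i)) (G.node (b i)) := by
  set ρ : Fin k ⊕ D → V := Sum.elim (G.node ∘ b) fun d : D => G.node d with hρ
  constructor
  · rintro ⟨⟨hF, hroot⟩, part, ha, hb, hd, hσ⟩
    have hrel : ∀ i j, (G.edgeGraph F).Reachable (G.node i) (G.node j) ↔ part i = part j :=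
      fun i j => iff_of_eq (congrFun₂ (congrArg (fun σ : Setoid N => (σ : N → N → Prop)) hσ) i j)
    have hx : ∀ x : Fin k ⊕ D, ∃ j, ρ x = G.node j ∧ part j = x := by
      rintro (x | x)
      · exact ⟨b x, rfl, hb x⟩
      · exact ⟨x, rfl, hd x⟩
    refine ⟨⟨hF, fun v => ?_⟩, fun i => (hrel _ _).2 ((ha i).trans (hb i).symm)⟩
    obtain ⟨i, hi⟩ := hroot v
    obtain ⟨j, hj, hj'⟩ := hx (part i)
    refine ⟨part i, ?_, fun y hy => ?_⟩
    · change (G.edgeGraph F).Reachable v (ρ (part i))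
      rw [hj]
      exact hi.trans ((hrel _ _).2 hj'.symm)
    · obtain ⟨l, hl, hl'⟩ := hx y
      have hy : (G.edgeGraph F).Reachable v (ρ y) := hy
      rw [hl] at hy
      rw [← hl']
      exact (hrel _ _).1 (hy.symm.trans hi)
  · rintro ⟨⟨hF, hroot⟩, hab⟩
    choose r hr hr' using hroot
    have hker : ∀ u v, (G.edgeGraph F).Reachable u v ↔ r u = r v := fun u v =>
      ⟨fun h => hr' v _ (h.symm.trans (hr u)), fun h => (hr u).trans (h ▸ (hr v).symm)⟩
    have hb : ∀ i, r (G.node (b i)) = Sum.inl i := fun i =>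
      (hr' _ (Sum.inl i) (SimpleGraph.Reachable.refl _)).symm
    refine ⟨⟨hF, fun v => ?_⟩, fun i => r (G.node i), fun i => ?_, hb, fun d => ?_, ?_⟩
    · rcases h : r v with x | x
      · exact ⟨b x, by simpa [h, hρ] using hr v⟩
      · exact ⟨x, by simpa [h, hρ] using hr v⟩
    · rw [← hb i]
      exact (hker _ _).1 (hab i)
    · exact (hr' _ (Sum.inr d) (SimpleGraph.Reachable.refl _)).symm
    · ext i j
      exact hker _ _

/-- If all the nodes are listed as singletons, then the only pairing is the uncrossing. -/
theorem _root_.isPairing_univ_iff {N : Type*} [Fintype N] {a b : Fin 0 → N} {σ : Setoid N} :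
    IsPairing a b Finset.univ σ ↔ IsUncrossing σ := by
  constructor
  · rintro ⟨part, -, -, hd, rfl⟩
    rw [IsUncrossing, Setoid.ker_eq_bot_iff]
    intro i j (hij : part i = part j)
    have hi := hd ⟨i, Finset.mem_univ i⟩
    have hj := hd ⟨j, Finset.mem_univ j⟩
    simpa using hi.symm.trans (hij.trans hj)
  · rintro rfl
    refine ⟨fun i => Sum.inr ⟨i, Finset.mem_univ i⟩, fun i => i.elim0, fun i => i.elim0,
      fun _ => rfl, ?_⟩
    refine (Setoid.ker_eq_bot_iff.2 fun i j hij => ?_).symm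
    simpa using hij

/-! ### The response matrix as a Schur complement -/

/-- The internal vertices. -/
abbrev Internal : Type _ := {v : V // v ∉ Set.range G.node}

/-- The inclusion of the internal vertices. -/
abbrev internal : G.Internal → V := Subtype.val

theorem bijective_node_internal :
    Function.Bijective (Sum.elim G.node G.internal) := by
  constructor
  · refine G.node.injective.sumElim Subtype.val_injective ?_
    rintro i ⟨v, hv⟩ rfl
    exact hv ⟨i, rfl⟩
  · intro v
    by_cases hv : v ∈ Set.range G.node
    · obtain ⟨i, rfl⟩ := hv
      exact ⟨Sum.inl i, rfl⟩
    · exact ⟨Sum.inr ⟨v, hv⟩, rfl⟩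

section Schur

variable [Fintype V] [Fintype E] [Fintype N] [DecidableEq V]

open Classical in
theorem laplacian_mulVec_eq_add (φ : V → ℝ) (v : V) : (G.laplacian.mulVec φ) v =
    ∑ i, G.laplacian v (G.node i) * φ (G.node i) +
      ∑ u : G.Internal, G.laplacian v u * φ u := by
  rw [Matrix.mulVec, dotProduct, ← G.bijective_node_internal.sum_comp, Fintype.sum_sum_type]
  rfl

open Classical in
/-- The internal block of the Laplacian is invertible, since a potential without internal loss that
vanishes at the nodes is zero. -/
theorem det_laplacian_internal_ne_zero :
    (G.laplacian.submatrix G.internal G.internal).det ≠ 0 := by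
  intro h0
  obtain ⟨x, hx, hx0⟩ := Matrix.exists_mulVec_eq_zero_iff.2 h0
  obtain ⟨φ, hφ⟩ : ∃ φ : V → ℝ, φ ∘ Sum.elim G.node G.internal =
      Sum.elim (0 : N → ℝ) x := ⟨Sum.elim (0 : N → ℝ) x ∘
        (Equiv.ofBijective _ G.bijective_node_internal).symm, by
    funext y
    exact congrArg _ (Equiv.symm_apply_apply (Equiv.ofBijective _ G.bijective_node_internal) y)⟩
  have hN : ∀ i, φ (G.node i) = 0 := fun i => congrFun hφ (Sum.inl i)
  have hI : ∀ u : G.Internal, φ u = x u := fun u => congrFun hφ (Sum.inr u)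
  have hφ0 : φ = 0 := by
    refine eq_zero_of_noInternalLoss (G := G) (fun v hv => ?_) hN
    rw [← neg_eq_zero, ← laplacian_mulVec, laplacian_mulVec_eq_add]
    simp only [hN, hI, mul_zero, Finset.sum_const_zero, zero_add]
    exact congrFun hx0 ⟨v, hv⟩
  exact hx (funext fun u => by rw [← hI, hφ0]; rfl)

open Classical in
open scoped Matrix in
/-- The response matrix is minus the Schur complement of the internal block of the Laplacian. -/
theorem responseMatrix_eq : G.responseMatrix =
    -(G.laplacian.submatrix G.node G.node -
      G.laplacian.submatrix G.node G.internal *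
        (G.laplacian.submatrix G.internal G.internal)⁻¹ *
          G.laplacian.submatrix G.internal G.node) := by
  refine Matrix.ext_of_mulVec_single fun j => ?_
  generalize (Pi.single j (1 : ℝ) : N → ℝ) = x
  obtain ⟨H, hH⟩ := G.exists_extension
  obtain ⟨hloss, hval⟩ := hH x
  set φ := H x
  have hL := G.isResponseMatrix_responseMatrix φ hloss
  have hx : (fun i => φ (G.node i)) = x := funext hval
  rw [hx] at hL
  let y : G.Internal → ℝ := fun u => φ u
  have hI : G.laplacian.submatrix G.internal G.node *ᵥ x +
      G.laplacian.submatrix G.internal G.internal *ᵥ y = 0 := by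
    funext u
    have h1 := G.laplacian_mulVec_eq_add φ u
    rw [laplacian_mulVec, hloss u u.2, neg_zero, ← hx] at *
    exact h1.symm
  have hdet := isUnit_iff_ne_zero.2 G.det_laplacian_internal_ne_zero
  have hy : (G.laplacian.submatrix G.internal G.internal)⁻¹ *ᵥ
      (G.laplacian.submatrix G.internal G.node *ᵥ x) = -y := by
    rw [eq_neg_of_add_eq_zero_left hI, Matrix.mulVec_neg, Matrix.mulVec_mulVec,
      Matrix.nonsing_inv_mul _ hdet, Matrix.one_mulVec]
  rw [hL, Matrix.neg_mulVec, Matrix.sub_mulVec, ← Matrix.mulVec_mulVec, ← Matrix.mulVec_mulVec, hy,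
    Matrix.mulVec_neg]
  funext i
  have h1 := G.laplacian_mulVec_eq_add φ (G.node i)
  rw [laplacian_mulVec] at h1
  rw [← neg_neg (G.netCurrent φ (G.node i)), h1, ← hx]
  simp [Matrix.mulVec, dotProduct, y]

open Classical in
/-- A minor of the response matrix is, up to sign, the corresponding minor of the Laplacian with all
the internal vertices added, divided by the minor of the internal vertices. -/
theorem det_responseMatrix_submatrix {n : Type*} [Fintype n] [DecidableEq n] (α β : n → N) :
    (G.laplacian.submatrix (Sum.elim (G.node ∘ α) G.internal)
        (Sum.elim (G.node ∘ β) G.internal)).det =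
      (G.laplacian.submatrix G.internal G.internal).det *
        ((-1) ^ Fintype.card n * (G.responseMatrix.submatrix α β).det) := by
  have hblock : G.laplacian.submatrix (Sum.elim (G.node ∘ α) G.internal)
      (Sum.elim (G.node ∘ β) G.internal) =
      Matrix.fromBlocks (G.laplacian.submatrix (G.node ∘ α) (G.node ∘ β))
        (G.laplacian.submatrix (G.node ∘ α) G.internal)
        (G.laplacian.submatrix G.internal (G.node ∘ β))
        (G.laplacian.submatrix G.internal G.internal) := by
    ext (x | x) (y | y) <;> rfl
  let _ := Matrix.invertibleOfIsUnitDet _ (isUnit_iff_ne_zero.2 G.det_laplacian_internal_ne_zero)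
  rw [hblock, Matrix.det_fromBlocks₂₂, ← Matrix.det_neg, Matrix.invOf_eq_nonsing_inv,
    responseMatrix_eq]
  congr 2
  exact (neg_neg _).symm

end Schur

/-! ### Minors of the Laplacian as sums over groves -/

/-- The internal vertices and the nodes in `A`, `B`, `C` and `D` are all the vertices, each listed
once.  The left summand collects the rows of a minor and the right summand the omitted vertices. -/
theorem bijective_vertices {A B C D : Finset N} [DecidableEq N]
    [Fintype N] (hAB : Disjoint A B) (hAC : Disjoint A C) (hAD : Disjoint A D)
    (hBC : Disjoint B C) (hBD : Disjoint B D) (hCD : Disjoint C D)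
    (hcover : A ∪ B ∪ C ∪ D = Finset.univ) {k : ℕ} (a : Fin k ≃ A) (b : Fin k ≃ B) :
    Function.Bijective (Sum.elim
      (Sum.elim (fun i => G.node (a i)) (Sum.elim (fun c : C => G.node c) G.internal))
      (Sum.elim (fun i => G.node (b i)) fun d : D => G.node d)) := by
  have hne : ∀ {X Y : Finset N}, Disjoint X Y → ∀ (x : X) (y : Y), G.node x ≠ G.node y :=
    fun h x y hxy => Finset.disjoint_left.1 h x.2 (G.node.injective hxy ▸ y.2)
  have hint : ∀ (i : N) (u : G.Internal), G.node i ≠ u := fun i u h => u.2 ⟨i, h⟩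
  have hinj : ∀ X : Finset N, Function.Injective fun x : X => G.node x := fun X =>
    G.node.injective.comp Subtype.val_injective
  constructor
  · refine Function.Injective.sumElim (((hinj A).comp a.injective).sumElim
      ((hinj C).sumElim Subtype.val_injective fun c u => hint c u) ?_)
      (((hinj B).comp b.injective).sumElim (hinj D) fun i d => hne hBD (b i) d) ?_
    · rintro i (c | u)
      · exact hne hAC (a i) c
      · exact hint _ u
    · rintro (i | c | u) (j | d)
      · exact hne hAB (a i) (b j)
      · exact hne hAD (a i) d
      · exact (hne hBC (b j) c).symm
      · exact hne hCD c d
      · exact (hint _ u).symm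
      · exact (hint _ u).symm
  · intro v
    obtain ⟨i | u, rfl⟩ := G.bijective_node_internal.surjective v
    · have hi : i ∈ A ∪ B ∪ C ∪ D := hcover ▸ Finset.mem_univ i
      simp only [Finset.mem_union] at hi
      obtain ((hi | hi) | hi) | hi := hi
      · exact ⟨Sum.inl (Sum.inl (a.symm ⟨i, hi⟩)), by simp⟩
      · exact ⟨Sum.inr (Sum.inl (b.symm ⟨i, hi⟩)), by simp⟩
      · exact ⟨Sum.inl (Sum.inr (Sum.inl ⟨i, hi⟩)), rfl⟩
      · exact ⟨Sum.inr (Sum.inr ⟨i, hi⟩), rfl⟩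
    · exact ⟨Sum.inl (Sum.inr (Sum.inr u)), rfl⟩

open Classical in
theorem det_laplacian_eq_sum_pairing [Fintype V] [Fintype E]
    [Fintype N] [DecidableEq N] {A B C D : Finset N}
    (hAB : Disjoint A B) (hAC : Disjoint A C) (hAD : Disjoint A D)
    (hBC : Disjoint B C) (hBD : Disjoint B D) (hCD : Disjoint C D)
    (hcover : A ∪ B ∪ C ∪ D = Finset.univ) {k : ℕ} (a : Fin k ≃ A) (b : Fin k ≃ B) :
    (G.laplacian.submatrix
        (Sum.elim (fun i => G.node (a i)) (Sum.elim (fun c : C => G.node c) G.internal))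
        (Sum.elim (fun i => G.node (b i)) (Sum.elim (fun c : C => G.node c) G.internal))).det =
      (-1) ^ k * ∑ π : Equiv.Perm (Fin k), ((Equiv.Perm.sign π : ℤ) : ℝ) *
        ∑ F : Finset E with G.IsGrove F ∧
          IsPairing (fun i => (a i : N)) (fun i => (b (π i) : N)) D (G.nodePartition F),
          ∏ e ∈ F, G.weight e := by
  rw [G.det_laplacian_submatrix
    (G.bijective_vertices hAB hAC hAD hBC hBD hCD hcover a b)
    (G.bijective_vertices hAB.symm hBC hBD hAC hAD hCD (Finset.union_comm A B ▸ hcover) b a),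
    Fintype.card_fin]
  refine congrArg _ (Finset.sum_congr rfl fun π _ => congrArg _ (Finset.sum_congr
    (Finset.ext fun F => ?_) fun _ _ => rfl))
  simp only [Finset.mem_filter, Finset.mem_univ, true_and]
  exact G.isGrove_and_isPairing_iff.symm

open Classical in
/-- The case without pairs: the internal principal minor is the total weight of the uncrossing
groves. -/
theorem det_laplacian_internal [Fintype V] [Fintype E]
    [Fintype N] :
    (G.laplacian.submatrix G.internal G.internal).det =
      ∑ F : Finset E with G.IsGrove F ∧ IsUncrossing (G.nodePartition F),
        ∏ e ∈ F, G.weight e := by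
  have h := G.det_laplacian_eq_sum_pairing (A := ∅) (B := ∅) (C := ∅) (D := Finset.univ)
    (by simp) (by simp) (by simp) (by simp) (by simp) (by simp) (by simp)
    (k := 0) (Equiv.equivOfIsEmpty _ _) (Equiv.equivOfIsEmpty _ _)
  simp only [isPairing_univ_iff] at h
  rw [Fintype.sum_unique, pow_zero, one_mul, Equiv.Perm.default_eq, Equiv.Perm.sign_one,
    Units.val_one, Int.cast_one, one_mul] at h
  rw [← h, ← Matrix.det_submatrix_equiv_self ((Equiv.emptySum (Fin 0) _).trans
    (Equiv.emptySum (∅ : Finset N) G.Internal)).symm]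
  rfl

end ResistorNetwork

theorem theorem8p1 {V E N : Type*} [Fintype V] [Fintype E] [Fintype N] [DecidableEq N]
    (G : ResistorNetwork V E N)
    (A B C D : Finset N)
    (hAB : Disjoint A B) (hAC : Disjoint A C) (hAD : Disjoint A D)
    (hBC : Disjoint B C) (hBD : Disjoint B D) (hCD : Disjoint C D)
    (hcover : A ∪ B ∪ C ∪ D = Finset.univ)
    (k : ℕ) (a : Fin k ≃ A) (b : Fin k ≃ B) :
    (G.responseMatrix.submatrix
        (Sum.elim (fun i => (a i : N)) (fun c : C => (c : N)))
        (Sum.elim (fun j => (b j : N)) (fun c : C => (c : N)))).det =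
      (-1) ^ C.card *
        ((∑ π : Equiv.Perm (Fin k), ((Equiv.Perm.sign π : ℤ) : ℝ) *
            G.Pr (IsPairing (fun i => (a i : N)) (fun i => (b (π i) : N)) D)) /
          G.Pr IsUncrossing) := by
  classical
  have hZ0 := G.det_laplacian_internal_ne_zero
  have hschur := G.det_responseMatrix_submatrix
    (Sum.elim (fun i => (a i : N)) (fun c : C => (c : N)))
    (Sum.elim (fun j => (b j : N)) (fun c : C => (c : N)))
  have hbig := G.det_laplacian_eq_sum_pairing hAB hAC hAD hBC hBD hCD hcover a b
  rw [← Matrix.det_submatrix_equiv_self (Equiv.sumAssoc _ _ _), Matrix.submatrix_submatrix] at hbig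
  have hassoc : ∀ x : Fin k → N,
      Sum.elim (fun i => G.node (x i)) (Sum.elim (fun c : C => G.node c) G.internal) ∘
        Equiv.sumAssoc (Fin k) C G.Internal =
      Sum.elim (G.node ∘ Sum.elim x fun c : C => (c : N)) G.internal := fun x => by
    ext ((i | i) | i) <;> rfl
  rw [hassoc, hassoc, hschur, Fintype.card_sum, Fintype.card_fin, Fintype.card_coe] at hbig
  have hZ : (∑ F : Finset E with G.IsGrove F, ∏ e ∈ F, G.weight e) ≠ 0 := by
    -- The uncrossing groves have nonzero total weight, so there is a grove.
    rw [G.det_laplacian_internal] at hZ0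
    obtain ⟨F, hF, -⟩ := Finset.exists_ne_zero_of_sum_ne_zero hZ0
    rw [Finset.mem_filter_univ] at hF
    exact (Finset.sum_pos (fun F _ => Finset.prod_pos fun e _ => G.weight_pos e)
      ⟨F, (Finset.mem_filter_univ F).2 hF.1⟩).ne'
  rw [G.det_laplacian_internal] at hbig hZ0
  simp only [ResistorNetwork.Pr, ← mul_div_assoc, ← Finset.sum_div]
  rw [div_div_div_cancel_right₀ hZ, eq_div_iff hZ0]
  have hs : ((-1 : ℝ) ^ k) * (-1) ^ k = 1 := by rw [← mul_pow]; simp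
  have hs' : ((-1 : ℝ) ^ C.card) * (-1) ^ C.card = 1 := by rw [← mul_pow]; simp
  have hsolve : ∀ L W S : ℝ, W * ((-1) ^ (k + C.card) * L) = (-1) ^ k * S →
      L * W = (-1) ^ C.card * S := fun L W S h => by
    rw [pow_add] at h
    linear_combination (-1) ^ k * (-1) ^ C.card * h -
      L * W * ((-1) ^ C.card * (-1) ^ C.card * hs + hs') + (-1) ^ C.card * S * hs
  exact hsolve _ _ _ hbig
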